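/- Let $\varphi_0\colon\mathbb R^n\to\mathbb R$ and $f\colon\mathbb R^n\to\mathbb R^m$ be twice differentiable at $\bar x$ (differentiable near $\bar x$, with derivative differentiable at $\bar x$), and let $\vartheta\colon\mathbb R^m\to(-\infty,\infty]$ be a convex piecewise linear-quadratic function with $f(\bar x)\in\operatorname{dom}\vartheta:=\{y\mid\vartheta(y)<\infty\}$; that is, $\operatorname{dom}\vartheta=\bigcup_{i=1}^s\Omega_i$ with polyhedral convex sets $\Omega_i$, and $\vartheta(y)=\tfrac12\langle A_iy,y\rangle+\langle a_i,y\rangle+\alpha_i$ for $y\in\Omega_i$, where $A_i$ is a symmetric $m\times m$ matrix, $a_i\in\mathbb R^m$, $\alpha_i\in\mathbb R$. Consider the composite problem of minimizing $\varphi_0(x)+\vartheta(f(x))$ over $x\in\mathbb R^n$, with Lagrangian $L(x,\lambda)=\varphi_0(x)+\langle\lambda,f(x)\rangle-\vartheta^*(\lambda)$, where $\vartheta^*(\lambda)=\sup_y\{\langle\lambda,y\rangle-\vartheta(y)\}$. Let $\partial\vartheta$ be the limiting subdifferential of $\vartheta$ (which is the subdifferential of convex analysis, as $\vartheta$ is convex),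 and let $(\bar x,\bar\lambda)$ be a solution of the KKT system $$\nabla_xL(x,\lambda)=0,\qquad\lambda\in\partial\vartheta(f(x)).$$ Set $\bar v:=-\nabla\varphi_0(\bar x)$ and let $\Lambda(\bar x,\bar v):=\{\lambda\in\mathbb R^m\mid\nabla f(\bar x)^*\lambda=\bar v,\ \lambda\in\partial\vartheta(f(\bar x))\}$ be the set of Lagrange multipliers. Then the following two conditions are equivalent: (i) $\Lambda(\bar x,\bar v)=\{\bar\lambda\}$; (ii) $(D\partial\vartheta)(f(\bar x),\bar\lambda)(0)\cap\ker\nabla f(\bar x)^*=\{0\}$. Moreover, $(D\partial\vartheta)(f(\bar x),\bar\lambda)(0)=K_\vartheta(f(\bar x),\bar\lambda)^*$. Here $(D\partial\vartheta)(\bar y,\bar\lambda)(u)$, the graphical derivative, is the set of all $v$ for which there are $t_k\downarrow0$ and $(u_k,v_k)\to(u,v)$ with $\bar\lambda+t_kv_k\in\partial\vartheta(\bar y+t_ku_k)$ for all $k$. The critical cone is $K_\vartheta(\bar y,\bar\lambda):=\{w\mid \mathrm d\vartheta(\bar y)(w)=\langle\bar\lambda,w\rangle\}$ with the subderivative $\mathrm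 d\vartheta(\bar y)(w):=\liminf_{t\downarrow0,\,w'\to w}\frac{\vartheta(\bar y+tw')-\vartheta(\bar y)}{t}$, and $K^*:=\{v\mid\langle v,w\rangle\le0\text{ for all }w\in K\}$ is the polar of $K$. -/

import Mathlib

open Set Filter Topology

noncomputable section

namespace CompositeOpt

variable {E F : Type*} [NormedAddCommGroup E] [InnerProductSpace ℝ E]
  [NormedAddCommGroup F] [InnerProductSpace ℝ F]

/-! ### Tangent and normal cones -/

/-- The tangent (contingent, Bouligand-Severi) cone to `Ω` at `x`: all limits of sequences `w k`
such that `x + t k • w k ∈ Ω` for some `t k ↓ 0`. -/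
def contingentCone {V : Type*} [AddCommGroup V] [Module ℝ V] [TopologicalSpace V]
    (Ω : Set V) (x : V) : Set V :=
  {w | ∃ (t : ℕ → ℝ) (u : ℕ → V), (∀ k, 0 < t k) ∧ Tendsto t atTop (𝓝 0) ∧
    Tendsto u atTop (𝓝 w) ∧ ∀ k, x + t k • u k ∈ Ω}

/-- The regular (Fréchet) normal cone to `Ω` at `x ∈ Ω`: all `v` such that the upper limit of
`⟪v, y - x⟫ / ‖y - x‖`, as `y → x` within `Ω`, is at most `0`. -/
def regularNormalCone (Ω : Set E) (x : E) : Set E :=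
  {v | ∀ ε : ℝ, 0 < ε → ∀ᶠ y in 𝓝[Ω] x, inner ℝ v (y - x) ≤ ε * ‖y - x‖}

/-- The limiting (Mordukhovich) normal cone to `Ω` at `x ∈ Ω`. -/
def limitingNormalCone (Ω : Set E) (x : E) : Set E :=
  {v | ∃ (y : ℕ → E) (u : ℕ → E), (∀ k, y k ∈ Ω) ∧ Tendsto y atTop (𝓝 x) ∧
    Tendsto u atTop (𝓝 v) ∧ ∀ k, u k ∈ regularNormalCone Ω (y k)}

/-- The polar `{v | ⟪v, w⟫ ≤ 0 for all w ∈ K}` of `K`. -/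
def polarCone (K : Set E) : Set E :=
  {v | ∀ w ∈ K, inner ℝ v w ≤ 0}

/-! ### Extended-real-valued functions -/

/-- The effective domain of `φ`. -/
def effDomain (φ : E → EReal) : Set E :=
  {x | φ x < ⊤}

/-- The epigraph of `φ`, in `E × ℝ` with its Euclidean (inner product) structure. -/
def epigraph (φ : E → EReal) : Set (WithLp 2 (E × ℝ)) :=
  {p | φ p.fst ≤ (p.snd : EReal)}

/-- An extended-real-valued function is convex if its epigraph is a convex set. -/
def IsConvexFun (φ : E → EReal) : Prop :=
  Convex ℝ (epigraph φ)

/-- The limiting subdifferential of `φ` at `x`: all `v` such that `(v, -1)` is a limiting normal to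
the epigraph at `(x, φ x)`; it is empty if `φ x` is not finite. -/
def limitingSubdiff (φ : E → EReal) (x : E) : Set E :=
  {v | φ x ≠ ⊤ ∧ φ x ≠ ⊥ ∧
    WithLp.toLp 2 (v, (-1 : ℝ)) ∈
      limitingNormalCone (epigraph φ) (WithLp.toLp 2 (x, (φ x).toReal))}

/-- The subderivative `dφ(x)(w)`: the lower limit of `(φ (x + t w') - φ x) / t` as
`t ↓ 0` and `w' → w`. -/
def subderivative (φ : E → EReal) (x w : E) : EReal :=
  liminf (fun p : ℝ × E => (φ (x + p.1 • p.2) - φ x) / (p.1 : EReal)) (𝓝[>] (0 : ℝ) ×ˢ 𝓝 w)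

/-- The critical cone of `φ` at `x` for `v`. -/
def criticalCone (φ : E → EReal) (x v : E) : Set E :=
  {w | subderivative φ x w = ((inner ℝ v w : ℝ) : EReal)}

/-- The Fenchel conjugate of `φ`. -/
def fenchelConj (φ : E → EReal) (v : E) : EReal :=
  ⨆ y : E, ((inner ℝ v y : ℝ) : EReal) - φ y

/-- A polyhedral convex set: the intersection of finitely many closed half-spaces. -/
def IsPolyhedralSet (S : Set E) : Prop :=
  ∃ (k : ℕ) (b : Fin k → E) (β : Fin k → ℝ), S = {x | ∀ j, inner ℝ (b j) x ≤ β j}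

/-- Piecewise linear-quadratic functions: the domain is a finite union of polyhedral convex sets,
on each of which `φ` is a (finite) linear-quadratic function. -/
def IsPWLQ (φ : E → EReal) : Prop :=
  ∃ (s : ℕ) (Ω : Fin s → Set E) (A : Fin s → (E →ₗ[ℝ] E)) (a : Fin s → E) (α : Fin s → ℝ),
    (∀ i, IsPolyhedralSet (Ω i)) ∧ (∀ i, (A i).IsSymmetric) ∧ effDomain φ = ⋃ i, Ω i ∧
    ∀ i, ∀ x ∈ Ω i,
      φ x = (((1 / 2 : ℝ) * inner ℝ (A i x) x + inner ℝ (a i) x + α i : ℝ) : EReal)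

/-! ### Set-valued mappings -/

/-- The graph of a set-valued mapping. -/
def setGraph (S : E → Set F) : Set (E × F) :=
  {p | p.2 ∈ S p.1}

/-- The graphical derivative `DS(x, y)(u)` of a set-valued mapping `S` at `(x, y) ∈ gph S`. -/
def graphicalDeriv (S : E → Set F) (x : E) (y : F) (u : E) : Set F :=
  {v | (u, v) ∈ contingentCone (setGraph S) (x, y)}

/-! ### The composite problem: minimize `φ₀ x + ϑ (f x)` -/

/-- `f` is differentiable near `x`, and its derivative is differentiable at `x`. -/
def TwiceDifferentiableAt (f : E → F) (x : E) : Prop :=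
  (∀ᶠ y in 𝓝 x, DifferentiableAt ℝ f y) ∧ DifferentiableAt ℝ (fderiv ℝ f) x

/-- The Lagrangian `L(x, l) = φ₀ x + ⟪l, f x⟫ - ϑ* l`. It is used where `l` is a subgradient of
`ϑ` at some point, so that `ϑ* l` is finite. -/
def lagrangian (φ₀ : E → ℝ) (f : E → F) (ϑ : F → EReal) (x : E) (l : F) : ℝ :=
  φ₀ x + inner ℝ l (f x) - (fenchelConj ϑ l).toReal

/-- `(x, l)` solves the KKT system `∇ₓ L(x, l) = 0`, `l ∈ ∂ϑ (f x)`. -/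
def IsKKT [CompleteSpace E] (φ₀ : E → ℝ) (f : E → F) (ϑ : F → EReal) (x : E) (l : F) : Prop :=
  HasGradientAt (fun x' => lagrangian φ₀ f ϑ x' l) 0 x ∧ l ∈ limitingSubdiff ϑ (f x)

/-- The set of Lagrange multipliers `{l | ∇f(x)* l = v, l ∈ ∂ϑ (f x)}`. -/
def multiplierSet [CompleteSpace E] [CompleteSpace F] (f : E → F) (ϑ : F → EReal)
    (x v : E) : Set F :=
  {l | ContinuousLinearMap.adjoint (fderiv ℝ f x) l = v ∧ l ∈ limitingSubdiff ϑ (f x)}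

/-- The kernel of the adjoint derivative `∇f(x)*`. -/
def kerAdjoint [CompleteSpace E] [CompleteSpace F] (f : E → F) (x : E) : Set F :=
  {l | ContinuousLinearMap.adjoint (fderiv ℝ f x) l = 0}

end CompositeOpt

end

open Set Filter Topology

/-! The heart of the matter is that the polar of the critical cone, the graphical derivative at `0`
and the feasible directions of the convex set `∂ϑ(f x̄)` at `λ̄` coincide. A polar vector is a
feasible direction (`exists_add_smul_mem_of_mem_polarCone`): subgradients at a point are cut out by
finitely many polyhedral cones, one per active piece, and Farkas' lemma bounds the vector on each
cone by a multiple of the slack of `λ̄`, so one small step keeps every inequality. Convexity puts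
feasible directions into the graphical derivative (`mem_graphicalDeriv_zero`). The graphical
derivative lies in the polar (`inner_nonpos_of_mem_graphicalDeriv`) by adding two subgradient
inequalities and using that `ϑ` is quadratic along critical directions. Multipliers form an affine
slice of `∂ϑ(f x̄)` parallel to `ker ∇f(x̄)*`, so uniqueness says that no nonzero feasible direction
lies in this kernel. -/

namespace CompositeOpt

/-! ### Farkas' lemma -/

section Farkas

/-- **Farkas' lemma**: a linear functional that is nonpositive wherever finitely many linear
functionals are nonpositive is a nonnegative combination of them. -/
theorem exists_nonneg_combination_of_nonpos {V : Type*} [AddCommGroup V] [Module ℝ V] :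
    ∀ {k : ℕ} (b : Fin k → V →ₗ[ℝ] ℝ) (v : V →ₗ[ℝ] ℝ),
      (∀ x, (∀ j, b j x ≤ 0) → v x ≤ 0) →
      ∃ c : Fin k → ℝ, (∀ j, 0 ≤ c j) ∧ ∀ x, v x = ∑ j, c j * b j x := by
  intro k
  induction k with
  | zero =>
    intro b v h
    refine ⟨0, fun j => le_rfl, fun x => ?_⟩
    have h1 := h x (fun j => j.elim0)
    have h2 := h (-x) (fun j => j.elim0)
    simp only [map_neg] at h2
    simp only [Finset.univ_eq_empty, Finset.sum_empty]
    linarith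
  | succ k ih =>
    intro b v h
    by_cases hv : ∀ x, (∀ j : Fin k, b j.succ x ≤ 0) → v x ≤ 0
    · obtain ⟨c, hc, hcv⟩ := ih (fun j => b j.succ) v hv
      refine ⟨Fin.cons 0 c, fun j => ?_, fun x => ?_⟩
      · refine Fin.cases ?_ (fun j => ?_) j <;> simp [hc]
      · simp [Fin.sum_univ_succ, hcv]
    -- Here `b 0` is indispensable. Projecting along `z` onto the kernel of `b 0` reduces to the
    -- remaining functionals; the signs at `z` make the coefficient of `b 0` nonnegative.
    · push Not at hv
      obtain ⟨z, hz, hvz⟩ := hv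
      have hbz : 0 < b 0 z := by
        by_contra! hcon
        exact absurd (h z (fun j => Fin.cases hcon hz j)) (not_le.mpr hvz)
      set β := b 0 z with hβ
      obtain ⟨c, hc, hcv⟩ := ih (fun j => b j.succ - (b j.succ z / β) • b 0)
        (v - (v z / β) • b 0) (by
          intro x hx
          have key := h (x - (b 0 x / β) • z) (by
            intro j
            refine Fin.cases ?_ (fun j => ?_) j
            · simp only [map_sub, map_smul, smul_eq_mul, ← hβ]
              rw [div_mul_cancel₀ _ hbz.ne', sub_self]
            · have := hx j
              simp only [LinearMap.sub_apply, LinearMap.smul_apply, smul_eq_mul] at this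
              simp only [map_sub, map_smul, smul_eq_mul]
              convert this using 1
              ring)
          simp only [map_sub, map_smul, smul_eq_mul] at key
          simp only [LinearMap.sub_apply, LinearMap.smul_apply, smul_eq_mul]
          convert key using 1
          ring)
      refine ⟨Fin.cons (v z / β - ∑ j, c j * (b j.succ z / β)) c, fun j => ?_, fun x => ?_⟩
      · refine Fin.cases ?_ (fun j => ?_) j
        · simp only [Fin.cons_zero, sub_nonneg]
          refine le_trans (Finset.sum_nonpos fun j _ => ?_) (div_pos hvz hbz).le
          exact mul_nonpos_of_nonneg_of_nonpos (hc j)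
            (div_nonpos_of_nonpos_of_nonneg (hz j) hbz.le)
        · simpa using hc j
      · have := hcv x
        simp only [LinearMap.sub_apply, LinearMap.smul_apply, smul_eq_mul, mul_sub,
          Finset.sum_sub_distrib] at this
        have h2 : ∑ j, c j * (b j.succ z / β * b 0 x)
            = (∑ j, c j * (b j.succ z / β)) * b 0 x := by
          rw [Finset.sum_mul]
          exact Finset.sum_congr rfl fun j _ => by ring
        rw [h2] at this
        simp only [Fin.sum_univ_succ, Fin.cons_zero, Fin.cons_succ]
        linarith

/-- If `v` is nonpositive on the part of a polyhedral cone where `h ≤ 0`, then `v` is bounded on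
the whole cone by a nonnegative multiple of `h`. -/
theorem exists_le_mul_of_nonpos {V : Type*} [AddCommGroup V] [Module ℝ V]
    {k : ℕ} (b : Fin k → V →ₗ[ℝ] ℝ) (h v : V →ₗ[ℝ] ℝ)
    (hv : ∀ x, (∀ j, b j x ≤ 0) → h x ≤ 0 → v x ≤ 0) :
    ∃ s : ℝ, 0 ≤ s ∧ ∀ x, (∀ j, b j x ≤ 0) → v x ≤ s * h x := by
  obtain ⟨c, hc, hcv⟩ := exists_nonneg_combination_of_nonpos
    (Fin.cons h b : Fin (k + 1) → V →ₗ[ℝ] ℝ) v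
    (fun x hx => hv x (fun j => by simpa using hx j.succ) (by simpa using hx 0))
  refine ⟨c 0, hc 0, fun x hx => ?_⟩
  rw [hcv x, Fin.sum_univ_succ]
  simp only [Fin.cons_zero, Fin.cons_succ, add_le_iff_nonpos_right]
  exact Finset.sum_nonpos fun j _ => mul_nonpos_of_nonneg_of_nonpos (hc _) (hx j)

end Farkas

variable {E F : Type*} [NormedAddCommGroup E] [InnerProductSpace ℝ E]
  [NormedAddCommGroup F] [InnerProductSpace ℝ F]

/-! ### Normals and subgradients under convexity -/

section Normals

theorem inner_nonpos_of_mem_regularNormalCone {Ω : Set E} (hΩ : Convex ℝ Ω) {x y v : E}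
    (hx : x ∈ Ω) (hy : y ∈ Ω) (hv : v ∈ regularNormalCone Ω x) : inner ℝ v (y - x) ≤ 0 := by
  have hlim : Tendsto (fun t : ℝ => x + t • (y - x)) (𝓝[>] 0) (𝓝[Ω] x) := by
    refine tendsto_nhdsWithin_iff.2 ⟨?_, ?_⟩
    · have : Continuous fun t : ℝ => x + t • (y - x) := by fun_prop
      simpa using (this.tendsto 0).mono_left nhdsWithin_le_nhds
    · filter_upwards [Ioo_mem_nhdsGT (zero_lt_one' ℝ)] with t ht
      exact hΩ.add_smul_sub_mem hx hy ⟨ht.1.le, ht.2.le⟩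
  have key : ∀ ε : ℝ, 0 < ε → inner ℝ v (y - x) ≤ ε * ‖y - x‖ := by
    intro ε hε
    obtain ⟨t, ht, ht0⟩ := ((hlim.eventually (hv ε hε)).and self_mem_nhdsWithin).exists
    have ht0 : 0 < t := ht0
    rw [add_sub_cancel_left, inner_smul_right, norm_smul, Real.norm_of_nonneg ht0.le] at ht
    exact le_of_mul_le_mul_left (by linarith) ht0
  have hlim2 : Tendsto (fun ε : ℝ => ε * ‖y - x‖) (𝓝[>] 0) (𝓝 0) := by
    have : Continuous fun ε : ℝ => ε * ‖y - x‖ := by fun_prop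
    simpa using (this.tendsto 0).mono_left nhdsWithin_le_nhds
  exact ge_of_tendsto hlim2 (eventually_nhdsWithin_of_forall fun ε hε => key ε hε)

/-- The limiting normal cone to a convex set is the normal cone of convex analysis. -/
theorem mem_limitingNormalCone_iff_of_convex {Ω : Set E} (hΩ : Convex ℝ Ω) {x v : E}
    (hx : x ∈ Ω) : v ∈ limitingNormalCone Ω x ↔ ∀ y ∈ Ω, inner ℝ v (y - x) ≤ 0 := by
  constructor
  · rintro ⟨z, u, hz, hzx, huv, hu⟩ y hy
    exact le_of_tendsto (huv.inner (tendsto_const_nhds.sub hzx))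
      (Eventually.of_forall fun k => inner_nonpos_of_mem_regularNormalCone hΩ (hz k) hy (hu k))
  · intro h
    refine ⟨fun _ => x, fun _ => v, fun _ => hx, tendsto_const_nhds, tendsto_const_nhds,
      fun _ ε hε => ?_⟩
    filter_upwards [self_mem_nhdsWithin] with y hy
    exact (h y hy).trans (by positivity)

/-- The limiting subdifferential of a convex function is the subdifferential of convex
analysis. -/
theorem mem_limitingSubdiff_iff_of_convex {φ : E → EReal} (hφ : IsConvexFun φ) {y v : E} {c : ℝ}
    (hc : φ y = c) :
    v ∈ limitingSubdiff φ y ↔ ∀ z (r : ℝ), φ z ≤ r → c + inner ℝ v (z - y) ≤ r := by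
  have hmem : WithLp.toLp 2 (y, c) ∈ epigraph φ := by simp [epigraph, hc]
  simp only [limitingSubdiff, hc, mem_ofPred_eq, EReal.coe_ne_top, ne_eq, not_false_eq_true,
    EReal.coe_ne_bot, true_and, EReal.toReal_coe]
  rw [mem_limitingNormalCone_iff_of_convex hφ hmem]
  constructor
  · intro h z r hr
    have := h (WithLp.toLp 2 (z, r)) hr
    simp [WithLp.prod_inner_apply] at this
    linarith
  · intro h p hp
    have := h p.fst p.snd hp
    simp [WithLp.prod_inner_apply]
    linarith

theorem convex_limitingSubdiff {φ : E → EReal} (hφ : IsConvexFun φ) {y : E} {c : ℝ}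
    (hc : φ y = c) : Convex ℝ (limitingSubdiff φ y) := by
  intro u hu v hv s t hs ht hst
  rw [mem_limitingSubdiff_iff_of_convex hφ hc] at *
  intro z r hr
  have h1 := mul_le_mul_of_nonneg_left (hu z r hr) hs
  have h2 := mul_le_mul_of_nonneg_left (hv z r hr) ht
  rw [inner_add_left, real_inner_smul_left, real_inner_smul_left]
  obtain rfl : t = 1 - s := by linarith
  linarith

end Normals

/-! ### Local structure of polyhedra -/

section Polyhedral

/-- The cone of directions satisfying the constraints `⟪b j, ·⟫ ≤ β j` that are active at `y`. -/
def activeCone {k : ℕ} (b : Fin k → E) (β : Fin k → ℝ) (y : E) : Set E :=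
  {w | ∀ j, inner ℝ (b j) y = β j → inner ℝ (b j) w ≤ 0}

/-- Active constraints do not increase along `w`, and the finitely many inactive ones keep their
slack by continuity. -/
theorem eventually_add_smul_mem {k : ℕ} {b : Fin k → E} {β : Fin k → ℝ} {y w : E}
    (hy : ∀ j, inner ℝ (b j) y ≤ β j) (hw : w ∈ activeCone b β y) :
    ∀ᶠ t : ℝ in 𝓝[>] 0, ∀ j, inner ℝ (b j) (y + t • w) ≤ β j := by
  rw [eventually_all]
  intro j
  rcases (hy j).eq_or_lt with h | h
  · filter_upwards [self_mem_nhdsWithin] with t ht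
    rw [inner_add_right, inner_smul_right, h]
    have := mul_nonpos_of_nonneg_of_nonpos (le_of_lt ht) (hw j h)
    linarith
  · have hcont : Continuous fun t : ℝ => inner ℝ (b j) (y + t • w) := by fun_prop
    have : Tendsto (fun t : ℝ => inner ℝ (b j) (y + t • w)) (𝓝[>] 0) (𝓝 (inner ℝ (b j) y)) := by
      simpa using (hcont.tendsto 0).mono_left nhdsWithin_le_nhds
    exact (this.eventually_lt_const h).mono fun t ht => ht.le

/-- A direction along which a polyhedral set is met arbitrarily close to `y` is in its active cone
at `y`. -/
theorem mem_activeCone_of_frequently {ι : Type*} {l : Filter ι} {T : ι → ℝ} {W : ι → E}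
    {k : ℕ} {b : Fin k → E} {β : Fin k → ℝ} {y w : E}
    (hT : Tendsto T l (𝓝[>] 0)) (hW : Tendsto W l (𝓝 w))
    (h : ∃ᶠ p in l, ∀ j, inner ℝ (b j) (y + T p • W p) ≤ β j) :
    (∀ j, inner ℝ (b j) y ≤ β j) ∧ w ∈ activeCone b β y := by
  have hT0 := hT.mono_right nhdsWithin_le_nhds
  constructor
  · intro j
    have hlim : Tendsto (fun p => inner ℝ (b j) (y + T p • W p)) l (𝓝 (inner ℝ (b j) y)) := by
      simpa using (tendsto_const_nhds (x := b j)).inner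
        ((tendsto_const_nhds (x := y)).add (hT0.smul hW))
    exact le_of_tendsto_of_frequently hlim (h.mono fun p hp => hp j)
  · intro j hj
    refine le_of_tendsto_of_frequently ((tendsto_const_nhds (x := b j)).inner hW) ?_
    refine (h.and_eventually (hT.eventually self_mem_nhdsWithin)).mono fun p hp => ?_
    have h1 := hp.1 j
    have h2 : 0 < T p := hp.2
    rw [inner_add_right, inner_smul_right, hj] at h1
    exact nonpos_of_mul_nonpos_right (by linarith) h2

end Polyhedral

/-! ### Linear-quadratic pieces -/

section Quadratic

/-- The linear-quadratic function `x ↦ ½⟪A x, x⟫ + ⟪a, x⟫ + α`. -/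
noncomputable def linQuad (A : E →ₗ[ℝ] E) (a : E) (α : ℝ) (x : E) : ℝ :=
  (1 / 2 : ℝ) * inner ℝ (A x) x + inner ℝ a x + α

theorem linQuad_add_smul {A : E →ₗ[ℝ] E} (hA : A.IsSymmetric) (a : E) (α : ℝ) (y w : E) (t : ℝ) :
    linQuad A a α (y + t • w) =
      linQuad A a α y + t * (inner ℝ (A y + a) w + t * (1 / 2 * inner ℝ (A w) w)) := by
  have h1 : (inner ℝ (A w) y : ℝ) = inner ℝ (A y) w := by rw [hA w y, real_inner_comm]
  simp only [linQuad, map_add, map_smul, inner_add_left, inner_add_right, real_inner_smul_left,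
    inner_smul_right, h1]
  ring

end Quadratic

/-- Explicit data of a convex piecewise linear-quadratic function, given by polyhedra in half-space
form. -/
structure PWLQData (φ : E → EReal) where
  s : ℕ
  k : Fin s → ℕ
  b : ∀ i, Fin (k i) → E
  β : ∀ i, Fin (k i) → ℝ
  A : Fin s → (E →ₗ[ℝ] E)
  a : Fin s → E
  α : Fin s → ℝ
  symm : ∀ i, (A i).IsSymmetric
  exists_piece : ∀ x, φ x < ⊤ → ∃ i, ∀ j, inner ℝ (b i j) x ≤ β i j
  eq_linQuad : ∀ i x, (∀ j, inner ℝ (b i j) x ≤ β i j) → φ x = linQuad (A i) (a i) (α i) x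

theorem IsPWLQ.nonempty_data {φ : E → EReal} (h : IsPWLQ φ) : Nonempty (PWLQData φ) := by
  obtain ⟨s, Ω, A, a, α, hΩ, hA, hdom, hφ⟩ := h
  choose k b β hb using hΩ
  refine ⟨⟨s, k, b, β, A, a, α, hA, fun x hx => ?_, fun i x hx => ?_⟩⟩
  · have : x ∈ ⋃ i, Ω i := hdom ▸ hx
    obtain ⟨i, hi⟩ := mem_iUnion.1 this
    rw [hb i] at hi
    exact ⟨i, hi⟩
  · exact hφ i x (by rw [hb i]; exact hx)

namespace PWLQData

variable {φ : E → EReal} (d : PWLQData φ)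

/-- The pieces containing `y`. -/
def Active (i : Fin d.s) (y : E) : Prop :=
  ∀ j, inner ℝ (d.b i j) y ≤ d.β i j

/-- The gradient at `y` of the linear-quadratic function on the piece `i`. -/
def grad (i : Fin d.s) (y : E) : E :=
  d.A i y + d.a i

theorem exists_real (d : PWLQData φ) {y : E} (hy : φ y < ⊤) : ∃ c : ℝ, φ y = c := by
  obtain ⟨i, hi⟩ := d.exists_piece y hy
  exact ⟨_, d.eq_linQuad i y hi⟩

theorem eq_coe_add {i : Fin d.s} {y w : E} {c t : ℝ} (hc : φ y = c) (hy : d.Active i y)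
    (ht : d.Active i (y + t • w)) :
    φ (y + t • w) =
      ((c + t * (inner ℝ (d.grad i y) w + t * (1 / 2 * inner ℝ (d.A i w) w)) : ℝ) : EReal) := by
  have h1 := d.eq_linQuad i y hy
  rw [hc, EReal.coe_eq_coe_iff] at h1
  rw [d.eq_linQuad i _ ht, linQuad_add_smul (d.symm i), h1]
  rfl

theorem exists_frequently {ι : Type*} {l : Filter ι} {X : ι → E}
    (h : ∃ᶠ p in l, φ (X p) < ⊤) : ∃ i, ∃ᶠ p in l, d.Active i (X p) := by
  by_contra! hcon
  refine h ((eventually_all.2 hcon).mono fun p hp hlt => ?_)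
  obtain ⟨i, hi⟩ := d.exists_piece _ hlt
  exact hp i hi

/-- Divide the subgradient inequality at `y + t • w` by `t` and let `t ↓ 0`; the quadratic term
vanishes. -/
theorem inner_le_of_mem_limitingSubdiff (hφ : IsConvexFun φ) {i : Fin d.s} {y v w : E}
    (hy : d.Active i y) (hw : w ∈ activeCone (d.b i) (d.β i) y)
    (hv : v ∈ limitingSubdiff φ y) : inner ℝ v w ≤ inner ℝ (d.grad i y) w := by
  have hc := d.eq_linQuad i y hy
  rw [mem_limitingSubdiff_iff_of_convex hφ hc] at hv
  have hcont : Continuous fun t : ℝ =>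
      inner ℝ (d.grad i y) w + t * (1 / 2 * inner ℝ (d.A i w) w) := by fun_prop
  have hlim : Tendsto (fun t : ℝ =>
      inner ℝ (d.grad i y) w + t * (1 / 2 * inner ℝ (d.A i w) w)) (𝓝[>] 0)
      (𝓝 (inner ℝ (d.grad i y) w)) := by
    simpa using (hcont.tendsto 0).mono_left nhdsWithin_le_nhds
  refine ge_of_tendsto hlim ?_
  filter_upwards [eventually_add_smul_mem hy hw, self_mem_nhdsWithin] with t ht ht0
  have ht0 : 0 < t := ht0
  have h2 := hv _ _ (d.eq_coe_add hc hy ht).le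
  rw [add_sub_cancel_left, inner_smul_right] at h2
  exact le_of_mul_le_mul_left (by linarith) ht0

/-- Convexity reduces the global inequality at `z` to points of the segment near `y`. Some piece
meets it arbitrarily close to `y`, so it is active at `y`, has `z - y` in its cone, and its slope
bounds `v` there. -/
theorem mem_limitingSubdiff_of_forall_inner_le (hφ : IsConvexFun φ) {y v : E} (hy : φ y < ⊤)
    (h : ∀ i, d.Active i y → ∀ w ∈ activeCone (d.b i) (d.β i) y,
      inner ℝ v w ≤ inner ℝ (d.grad i y) w) :
    v ∈ limitingSubdiff φ y := by
  obtain ⟨c, hc⟩ := d.exists_real hy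
  rw [mem_limitingSubdiff_iff_of_convex hφ hc]
  intro z r hr
  have hconv : ∀ t ∈ Ioo (0 : ℝ) 1, φ (y + t • (z - y)) ≤ ((c + t * (r - c) : ℝ) : EReal) := by
    intro t ht
    have h1 : WithLp.toLp 2 (y, c) ∈ epigraph φ := by simp [epigraph, hc]
    have h2 : WithLp.toLp 2 (z, r) ∈ epigraph φ := hr
    have := Convex.add_smul_sub_mem hφ h1 h2 ⟨ht.1.le, ht.2.le⟩
    simpa [epigraph] using this
  have hIoo := Ioo_mem_nhdsGT (zero_lt_one' ℝ)
  obtain ⟨i, hi⟩ := d.exists_frequently (l := 𝓝[>] (0 : ℝ)) (X := fun t => y + t • (z - y))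
    (Eventually.frequently (by
      filter_upwards [hIoo] with t ht
      exact (hconv t ht).trans_lt (EReal.coe_lt_top _)))
  obtain ⟨hiy, hiw⟩ := mem_activeCone_of_frequently (T := fun t : ℝ => t) tendsto_id
    tendsto_const_nhds hi
  have hcont : Continuous fun t : ℝ =>
      inner ℝ (d.grad i y) (z - y) + t * (1 / 2 * inner ℝ (d.A i (z - y)) (z - y)) := by fun_prop
  have hlim : Tendsto (fun t : ℝ =>
      inner ℝ (d.grad i y) (z - y) + t * (1 / 2 * inner ℝ (d.A i (z - y)) (z - y))) (𝓝[>] 0)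
      (𝓝 (inner ℝ (d.grad i y) (z - y))) := by
    simpa using (hcont.tendsto 0).mono_left nhdsWithin_le_nhds
  have h1 : inner ℝ (d.grad i y) (z - y) ≤ r - c := by
    refine le_of_tendsto_of_frequently hlim ((hi.and_eventually hIoo).mono fun t ht => ?_)
    have h2 := hconv t ht.2
    rw [d.eq_coe_add hc hiy ht.1, EReal.coe_le_coe_iff] at h2
    exact le_of_mul_le_mul_left (by linarith) ht.2.1
  have h2 := h i hiy _ hiw
  linarith

/-! ### Subderivative and critical cone -/

/-- A subgradient is a lower bound of the subderivative. -/
theorem inner_le_subderivative {c : ℝ} {y v w : E} (hφ : IsConvexFun φ) (hc : φ y = c)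
    (hv : v ∈ limitingSubdiff φ y) : ((inner ℝ v w : ℝ) : EReal) ≤ subderivative φ y w := by
  rw [mem_limitingSubdiff_iff_of_convex hφ hc] at hv
  have hlim : Tendsto (fun p : ℝ × E => ((inner ℝ v p.2 : ℝ) : EReal)) (𝓝[>] (0 : ℝ) ×ˢ 𝓝 w)
      (𝓝 ((inner ℝ v w : ℝ) : EReal)) :=
    (continuous_coe_real_ereal.tendsto _).comp
      ((tendsto_const_nhds (x := v)).inner tendsto_snd)
  rw [← hlim.liminf_eq]
  refine liminf_le_liminf ?_
  filter_upwards [tendsto_fst.eventually (self_mem_nhdsWithin (a := (0 : ℝ)) (s := Ioi 0))]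
    with p hp
  have hp : 0 < p.1 := hp
  rw [EReal.le_div_iff_mul_le (by exact_mod_cast hp) (EReal.coe_ne_top _), hc]
  rw [EReal.le_sub_iff_add_le (by simp) (by simp)]
  refine EReal.le_of_forall_lt_iff_le.1 fun r hr => ?_
  have := hv _ r hr.le
  rw [add_sub_cancel_left, inner_smul_right] at this
  rw [← EReal.coe_mul, ← EReal.coe_add, EReal.coe_le_coe_iff]
  linarith

theorem subderivative_le {i : Fin d.s} {y w : E} (hy : d.Active i y)
    (hw : w ∈ activeCone (d.b i) (d.β i) y) :
    subderivative φ y w ≤ ((inner ℝ (d.grad i y) w : ℝ) : EReal) := by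
  have hc := d.eq_linQuad i y hy
  have hcont : Continuous fun t : ℝ =>
      inner ℝ (d.grad i y) w + t * (1 / 2 * inner ℝ (d.A i w) w) := by fun_prop
  have hlim : Tendsto (fun t : ℝ =>
      inner ℝ (d.grad i y) w + t * (1 / 2 * inner ℝ (d.A i w) w)) (𝓝[>] 0)
      (𝓝 (inner ℝ (d.grad i y) w)) := by
    simpa using (hcont.tendsto 0).mono_left nhdsWithin_le_nhds
  have hq : Tendsto (fun t : ℝ => (φ (y + t • w) - φ y) / (t : EReal)) (𝓝[>] 0)
      (𝓝 ((inner ℝ (d.grad i y) w : ℝ) : EReal)) := by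
    refine ((continuous_coe_real_ereal.tendsto _).comp hlim).congr' ?_
    filter_upwards [eventually_add_smul_mem hy hw, self_mem_nhdsWithin] with t ht ht0
    have ht0 : 0 < t := ht0
    rw [d.eq_coe_add hc hy ht, hc, ← EReal.coe_sub, ← EReal.coe_div, Function.comp_apply,
      EReal.coe_eq_coe_iff]
    field_simp
    ring
  have hmap : Tendsto (fun t : ℝ => (t, w)) (𝓝[>] (0 : ℝ)) (𝓝[>] (0 : ℝ) ×ˢ 𝓝 w) :=
    tendsto_id.prodMk tendsto_const_nhds
  rw [← hq.liminf_eq]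
  exact le_of_le_of_eq (liminf_le_liminf_of_le hmap) rfl

/-- A finite subderivative is the directional derivative of one of the active pieces, up to an
upper bound. -/
theorem exists_active_inner_le [FiniteDimensional ℝ E] {y w : E} {c r : ℝ} (hc : φ y = c)
    (h : subderivative φ y w ≤ r) :
    ∃ i, d.Active i y ∧ w ∈ activeCone (d.b i) (d.β i) y ∧ inner ℝ (d.grad i y) w ≤ r := by
  set l : Filter (ℝ × E) := 𝓝[>] (0 : ℝ) ×ˢ 𝓝 w with hl
  have hfreq : ∀ ε : ℝ, 0 < ε → ∃ᶠ p in l,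
      (φ (y + p.1 • p.2) - φ y) / (p.1 : EReal) < ((r + ε : ℝ) : EReal) := by
    intro ε hε
    refine frequently_lt_of_liminf_lt (by isBoundedDefault) (h.trans_lt ?_)
    exact EReal.coe_lt_coe_iff.2 (by linarith)
  have hpos : ∀ᶠ p in l, 0 < p.1 :=
    tendsto_fst.eventually (self_mem_nhdsWithin (a := (0 : ℝ)) (s := Ioi 0))
  -- Pigeonhole with one piece for all `ε`: if each piece failed at its own `ε i`, all would fail at
  -- the smallest of these.
  obtain ⟨i, hi⟩ : ∃ i, ∀ ε : ℝ, 0 < ε → ∃ᶠ p in l, d.Active i (y + p.1 • p.2) ∧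
      (φ (y + p.1 • p.2) - φ y) / (p.1 : EReal) < ((r + ε : ℝ) : EReal) := by
    by_contra! hcon
    choose ε hε hnot using hcon
    obtain ⟨δ, hδ, hδε⟩ : ∃ δ : ℝ, 0 < δ ∧ ∀ i, δ ≤ ε i := by
      rcases isEmpty_or_nonempty (Fin d.s) with he | he
      · exact ⟨1, one_pos, fun i => he.elim i⟩
      · obtain ⟨i₀, hi₀⟩ := Finite.exists_min ε
        exact ⟨ε i₀, hε i₀, hi₀⟩
    refine hfreq δ hδ ?_
    filter_upwards [eventually_all.2 hnot, hpos] with p hp hp0 hlt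
    have hfin : φ (y + p.1 • p.2) < ⊤ := by
      by_contra! htop
      rw [top_le_iff.1 htop, hc, EReal.top_sub_coe, EReal.top_div_of_pos_ne_top
        (by exact_mod_cast hp0) (EReal.coe_ne_top _)] at hlt
      exact not_top_lt hlt
    obtain ⟨i, hi⟩ := d.exists_piece _ hfin
    refine absurd (hlt.trans_le ?_) (not_lt.2 (hp i hi))
    exact EReal.coe_le_coe_iff.2 (by linarith [hδε i])
  obtain ⟨hiy, hiw⟩ := mem_activeCone_of_frequently (T := fun p : ℝ × E => p.1)
    (W := fun p => p.2) tendsto_fst tendsto_snd ((hi 1 one_pos).mono fun p hp => hp.1)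
  refine ⟨i, hiy, hiw, le_of_forall_pos_le_add fun ε hε => ?_⟩
  have hA : Continuous (d.A i) := (d.A i).continuous_of_finiteDimensional
  have hcont : Continuous fun p : ℝ × E =>
      inner ℝ (d.grad i y) p.2 + p.1 * (1 / 2 * inner ℝ (d.A i p.2) p.2) := by fun_prop
  have hle : l ≤ 𝓝 ((0 : ℝ), w) := by
    rw [nhds_prod_eq]
    exact Filter.prod_mono nhdsWithin_le_nhds le_rfl
  have hlim : Tendsto (fun p : ℝ × E =>
      inner ℝ (d.grad i y) p.2 + p.1 * (1 / 2 * inner ℝ (d.A i p.2) p.2)) l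
      (𝓝 (inner ℝ (d.grad i y) w)) := by
    simpa using (hcont.tendsto (0, w)).mono_left hle
  refine le_of_tendsto_of_frequently hlim (((hi ε hε).and_eventually hpos).mono fun p hp => ?_)
  obtain ⟨⟨hp1, hp2⟩, hp0⟩ := hp
  rw [d.eq_coe_add hc hiy hp1, hc, ← EReal.coe_sub, ← EReal.coe_div, EReal.coe_lt_coe_iff,
    add_sub_cancel_left, mul_div_cancel_left₀ _ hp0.ne'] at hp2
  exact hp2.le

/-- The subderivative is squeezed between the subgradient `v` and the slope of the piece. -/
theorem mem_criticalCone_of_inner_le (hφ : IsConvexFun φ) {i : Fin d.s} {y v w : E}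
    (hy : d.Active i y) (hw : w ∈ activeCone (d.b i) (d.β i) y) (hv : v ∈ limitingSubdiff φ y)
    (h : inner ℝ (d.grad i y) w ≤ inner ℝ v w) : w ∈ criticalCone φ y v :=
  le_antisymm ((d.subderivative_le hy hw).trans (EReal.coe_le_coe_iff.2 h))
    (inner_le_subderivative hφ (d.eq_linQuad i y hy) hv)

/-! ### Graphical derivative at zero and polar of the critical cone -/

theorem inner_nonpos_of_mem_graphicalDeriv [FiniteDimensional ℝ E] (d : PWLQData φ) (hφ : IsConvexFun φ)
    {y lam v w : E} (hy : φ y < ⊤) (hlam : lam ∈ limitingSubdiff φ y)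
    (hv : v ∈ graphicalDeriv (limitingSubdiff φ) y lam 0) (hw : w ∈ criticalCone φ y lam) :
    inner ℝ v w ≤ 0 := by
  obtain ⟨c, hc⟩ := d.exists_real hy
  obtain ⟨i, hiy, hiw, hi⟩ := d.exists_active_inner_le hc (le_of_eq hw)
  obtain ⟨t, p, ht0, htlim, hp, hmem⟩ := hv
  have hu : Tendsto (fun k => (p k).1) atTop (𝓝 0) := (continuous_fst.tendsto _).comp hp
  have hvv : Tendsto (fun k => (p k).2) atTop (𝓝 v) := (continuous_snd.tendsto _).comp hp
  rw [mem_limitingSubdiff_iff_of_convex hφ hc] at hlam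
  set C : ℝ := 1 / 2 * inner ℝ (d.A i w) w with hC
  -- The test point is `y + (σ * t k) • w`, with `σ` fixed while `k → ∞`. In the sum of the
  -- inequalities for `lam` at `y` and for `lam + t k • (p k).2` at `y + t k • (p k).1` the
  -- first-order terms cancel or have the right sign, leaving order `t k ^ 2`. Only then does `σ ↓
  -- 0`, which removes the curvature `C`.
  have key : ∀ σ : ℝ, 0 < σ → inner ℝ v w ≤ σ * C := by
    intro σ hσ
    have hlim : Tendsto (fun k => σ * inner ℝ (p k).2 w - inner ℝ (p k).2 (p k).1) atTop
        (𝓝 (σ * inner ℝ v w)) := by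
      simpa using ((hvv.inner (tendsto_const_nhds (x := w))).const_mul σ).sub (hvv.inner hu)
    have hst : Tendsto (fun k => σ * t k) atTop (𝓝[>] 0) := by
      refine tendsto_nhdsWithin_iff.2 ⟨by simpa using htlim.const_mul σ, ?_⟩
      exact Eventually.of_forall fun k => mul_pos hσ (ht0 k)
    have hle : σ * inner ℝ v w ≤ σ * (σ * C) := by
      refine le_of_tendsto hlim ?_
      filter_upwards [hst.eventually (eventually_add_smul_mem hiy hiw)] with k hk
      have hs : lam + t k • (p k).2 ∈ limitingSubdiff φ (y + t k • (p k).1) := hmem k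
      have hφk := d.eq_coe_add hc hiy hk
      obtain ⟨c', hc'⟩ := d.exists_real (lt_top_iff_ne_top.2 hs.1)
      have h1 := hlam _ c' hc'.le
      rw [mem_limitingSubdiff_iff_of_convex hφ hc'] at hs
      have h2 := hs _ _ hφk.le
      have h3 : y + (σ * t k) • w - (y + t k • (p k).1) = t k • (σ • w - (p k).1) := by
        module
      rw [h3] at h2
      simp only [add_sub_cancel_left, inner_add_left, inner_smul_right, inner_sub_right,
        real_inner_smul_left, ← hC] at h1 h2
      have h4 := mul_le_mul_of_nonneg_left hi (mul_pos hσ (ht0 k)).le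
      have h5 : t k ^ 2 * (σ * inner ℝ (p k).2 w - inner ℝ (p k).2 (p k).1)
          ≤ t k ^ 2 * (σ * (σ * C)) := by
        nlinarith [h1, h2, h4]
      exact le_of_mul_le_mul_left h5 (pow_pos (ht0 k) 2)
    exact le_of_mul_le_mul_left hle hσ
  have hlim2 : Tendsto (fun σ : ℝ => σ * C) (𝓝[>] 0) (𝓝 0) := by
    have : Continuous fun σ : ℝ => σ * C := by fun_prop
    simpa using (this.tendsto 0).mono_left nhdsWithin_le_nhds
  exact ge_of_tendsto hlim2 (eventually_nhdsWithin_of_forall fun σ hσ => key σ hσ)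

/-- Every polar of the critical cone is a feasible direction of the subdifferential. -/
theorem exists_add_smul_mem_of_mem_polarCone (d : PWLQData φ) (hφ : IsConvexFun φ)
    {y lam v : E} (hy : φ y < ⊤) (hlam : lam ∈ limitingSubdiff φ y)
    (hv : v ∈ polarCone (criticalCone φ y lam)) :
    ∃ t : ℝ, 0 < t ∧ lam + t • v ∈ limitingSubdiff φ y := by
  classical
  have hpiece : ∀ i, ∃ σ : ℝ, 0 ≤ σ ∧ (d.Active i y → ∀ w ∈ activeCone (d.b i) (d.β i) y,
      inner ℝ v w ≤ σ * inner ℝ (d.grad i y - lam) w) := by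
    intro i
    by_cases hi : d.Active i y
    swap
    · exact ⟨0, le_rfl, fun h => absurd h hi⟩
    -- Inactive constraints become the zero functional, so the index type stays `Fin (d.k i)`.
    have hcone : ∀ w, (∀ j, (if inner ℝ (d.b i j) y = d.β i j then innerₗ E (d.b i j) else 0) w
        ≤ 0) ↔ w ∈ activeCone (d.b i) (d.β i) y := by
      intro w
      refine forall_congr' fun j => ?_
      split_ifs with hj <;> simp [hj]
    obtain ⟨σ, hσ, hle⟩ := exists_le_mul_of_nonpos
      (fun j => if inner ℝ (d.b i j) y = d.β i j then innerₗ E (d.b i j) else 0)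
      (innerₗ E (d.grad i y - lam)) (innerₗ E v) (by
        intro w hw hh
        have hw' := (hcone w).1 hw
        refine hv w (d.mem_criticalCone_of_inner_le hφ hi hw' hlam ?_)
        simpa [inner_sub_left] using hh)
    exact ⟨σ, hσ, fun _ w hw => hle w ((hcone w).2 hw)⟩
  choose σ hσ hle using hpiece
  -- One constant dominating every `σ i`; the summand `1` keeps it invertible. Enlarging `σ i` to it
  -- is harmless because the slack `h0` is nonnegative.
  have hsum : 0 < 1 + ∑ i, σ i := by
    have := Finset.sum_nonneg fun i (_ : i ∈ Finset.univ) => hσ i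
    linarith
  refine ⟨(1 + ∑ i, σ i)⁻¹, inv_pos.2 hsum,
    d.mem_limitingSubdiff_of_forall_inner_le hφ hy fun i hi w hw => ?_⟩
  have h1 := hle i hi w hw
  have h0 : 0 ≤ inner ℝ (d.grad i y - lam) w := by
    rw [inner_sub_left]
    linarith [d.inner_le_of_mem_limitingSubdiff hφ hi hw hlam]
  have h2 : σ i ≤ 1 + ∑ i, σ i := by
    have := Finset.single_le_sum (fun i _ => hσ i) (Finset.mem_univ i)
    linarith
  have h3 : inner ℝ v w ≤ (1 + ∑ i, σ i) * inner ℝ (d.grad i y - lam) w :=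
    h1.trans (mul_le_mul_of_nonneg_right h2 h0)
  have h4 : (1 + ∑ i, σ i)⁻¹ * inner ℝ v w ≤ inner ℝ (d.grad i y - lam) w :=
    (inv_mul_le_iff₀ hsum).2 h3
  rw [inner_sub_left] at h4
  rw [inner_add_left, real_inner_smul_left]
  linarith

end PWLQData

/-- A feasible direction of `S y` at `lam` belongs to the graphical derivative of `S` at `0`, if
`S y` is convex. -/
theorem mem_graphicalDeriv_zero {S : E → Set F} {y : E} {lam v : F} (hS : Convex ℝ (S y))
    (hlam : lam ∈ S y) {t : ℝ} (ht : 0 < t) (h : lam + t • v ∈ S y) :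
    v ∈ graphicalDeriv S y lam 0 := by
  refine ⟨fun k => t * (1 / ((k : ℝ) + 1)), fun _ => (0, v), fun k => by positivity, ?_,
    tendsto_const_nhds, fun k => ?_⟩
  · simpa using tendsto_one_div_add_atTop_nhds_zero_nat.const_mul t
  · have h1 := hS.add_smul_mem hlam h (t := 1 / ((k : ℝ) + 1)) ⟨by positivity, by
      rw [div_le_one (by positivity)]
      linarith [k.cast_nonneg (α := ℝ)]⟩
    simpa [setGraph, smul_smul, mul_comm] using h1

theorem graphicalDeriv_limitingSubdiff_zero [FiniteDimensional ℝ E] {φ : E → EReal}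
    (hφ : IsConvexFun φ) (hpwlq : IsPWLQ φ) {y lam : E} (hy : y ∈ effDomain φ)
    (hlam : lam ∈ limitingSubdiff φ y) :
    graphicalDeriv (limitingSubdiff φ) y lam 0 = polarCone (criticalCone φ y lam) := by
  obtain ⟨d⟩ := hpwlq.nonempty_data
  obtain ⟨c, hc⟩ := d.exists_real hy
  ext v
  constructor
  · exact fun hv w hw => d.inner_nonpos_of_mem_graphicalDeriv hφ hy hlam hv hw
  · intro hv
    obtain ⟨t, ht, hmem⟩ := d.exists_add_smul_mem_of_mem_polarCone hφ hy hlam hv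
    exact mem_graphicalDeriv_zero (convex_limitingSubdiff hφ hc) hlam ht hmem

/-- The stationarity condition of the KKT system, in terms of the gradient of `φ₀`. -/
theorem adjoint_eq_neg_gradient_of_isKKT [CompleteSpace E] [CompleteSpace F] {φ₀ : E → ℝ}
    {f : E → F} {ϑ : F → EReal} {x : E} {lam : F} (hφ₀ : DifferentiableAt ℝ φ₀ x)
    (hf : DifferentiableAt ℝ f x) (h : IsKKT φ₀ f ϑ x lam) :
    ContinuousLinearMap.adjoint (fderiv ℝ f x) lam = -gradient φ₀ x := by
  have h1 : HasFDerivAt (fun x' => lagrangian φ₀ f ϑ x' lam)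
      (fderiv ℝ φ₀ x + (innerSL ℝ lam).comp (fderiv ℝ f x)) x :=
    -- The conjugate term does not depend on `x'`.
    (hφ₀.hasFDerivAt.add ((innerSL ℝ lam).hasFDerivAt.comp x hf.hasFDerivAt)).sub_const _
  have h2 := h1.unique h.1.hasFDerivAt
  rw [eq_neg_iff_add_eq_zero]
  refine ext_inner_right ℝ fun w => ?_
  have h3 := congrArg (fun L : E →L[ℝ] ℝ => L w) h2
  simp only [add_apply, ContinuousLinearMap.comp_apply, innerSL_apply_apply,
    map_zero, zero_apply] at h3
  rw [inner_add_left, ContinuousLinearMap.adjoint_inner_left, inner_zero_left, gradient,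
    InnerProductSpace.toDual_symm_apply]
  linarith

end CompositeOpt

/-! ### Uniqueness of the multiplier -/

theorem theorem8p1 {n m : ℕ}
    (φ₀ : EuclideanSpace ℝ (Fin n) → ℝ)
    (f : EuclideanSpace ℝ (Fin n) → EuclideanSpace ℝ (Fin m))
    (ϑ : EuclideanSpace ℝ (Fin m) → EReal)
    (xbar : EuclideanSpace ℝ (Fin n)) (lbar : EuclideanSpace ℝ (Fin m))
    (hφ₀ : CompositeOpt.TwiceDifferentiableAt φ₀ xbar)
    (hf : CompositeOpt.TwiceDifferentiableAt f xbar)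
    (hconv : CompositeOpt.IsConvexFun ϑ)
    (hpwlq : CompositeOpt.IsPWLQ ϑ)
    (hdom : f xbar ∈ CompositeOpt.effDomain ϑ)
    (hKKT : CompositeOpt.IsKKT φ₀ f ϑ xbar lbar) :
    (CompositeOpt.multiplierSet f ϑ xbar (-gradient φ₀ xbar) = {lbar} ↔
      CompositeOpt.graphicalDeriv (CompositeOpt.limitingSubdiff ϑ) (f xbar) lbar 0 ∩
        CompositeOpt.kerAdjoint f xbar = {0}) ∧
    CompositeOpt.graphicalDeriv (CompositeOpt.limitingSubdiff ϑ) (f xbar) lbar 0 =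
      CompositeOpt.polarCone (CompositeOpt.criticalCone ϑ (f xbar) lbar) := by
  have hlam := hKKT.2
  have hadj := CompositeOpt.adjoint_eq_neg_gradient_of_isKKT hφ₀.1.self_of_nhds
    hf.1.self_of_nhds hKKT
  have hpolar := CompositeOpt.graphicalDeriv_limitingSubdiff_zero hconv hpwlq hdom hlam
  obtain ⟨d⟩ := hpwlq.nonempty_data
  obtain ⟨c, hc⟩ := d.exists_real hdom
  have hS := CompositeOpt.convex_limitingSubdiff hconv hc
  refine ⟨⟨fun h => ?_, fun h => ?_⟩, hpolar⟩
  · refine Subset.antisymm ?_ ?_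
    · rintro v ⟨hv, hker⟩
      rw [hpolar] at hv
      obtain ⟨t, ht, hmem⟩ := d.exists_add_smul_mem_of_mem_polarCone hconv hdom hlam hv
      have hker : ContinuousLinearMap.adjoint (fderiv ℝ f xbar) v = 0 := hker
      -- A feasible step inside the kernel yields another multiplier, so uniqueness forces `v = 0`.
      have : lbar + t • v ∈ CompositeOpt.multiplierSet f ϑ xbar (-gradient φ₀ xbar) :=
        ⟨by rw [map_add, map_smul, hker, smul_zero, add_zero, hadj], hmem⟩
      rw [h, mem_singleton_iff, add_eq_left, smul_eq_zero] at this
      exact this.resolve_left ht.ne'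
    · rintro v rfl
      exact ⟨CompositeOpt.mem_graphicalDeriv_zero hS hlam one_pos (by simpa using hlam),
        map_zero _⟩
  · refine Subset.antisymm ?_ ?_
    · rintro l ⟨hl, hmem⟩
      -- The difference of two multipliers is a feasible direction with step `1`.
      have : l - lbar ∈ CompositeOpt.graphicalDeriv (CompositeOpt.limitingSubdiff ϑ) (f xbar)
          lbar 0 ∩ CompositeOpt.kerAdjoint f xbar :=
        ⟨CompositeOpt.mem_graphicalDeriv_zero hS hlam one_pos (by simpa using hmem), by
          change ContinuousLinearMap.adjoint (fderiv ℝ f xbar) (l - lbar) = 0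
          rw [map_sub, hl, hadj, sub_self]⟩
      rw [h] at this
      exact sub_eq_zero.1 this
    · rintro l rfl
      exact ⟨hadj, hlam⟩
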